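/- Let $q\ge 1$ be a fixed integer and let $K_n,P_n$ be integers with $q\le K_n\le P_n$ for all large $n$. Each of $n$ sensors independently receives a key ring, a uniformly random $K_n$-element subset of a pool of $P_n$ keys. In the $q$-composite network under full visibility, two distinct sensors have a secure link iff their key rings share at least $q$ keys. If an adversary captures a set $S$ of sensors, the compromised keys are all keys in the key rings of the sensors of $S$. Suppose that for some constant $c>1$ we have $\frac{1}{q!}\cdot\frac{K_n^{2q}}{P_n^{q}}\ge \frac{c\ln n}{n}$ for all sufficiently large $n$, and that $K_n=\omega(\ln n)$ and $K_n=o\big(\min\{\sqrt{P_n},\,P_n/n\}\big)$ as $n\to\infty$. Then: 1. The network is unsplittable: for every sequence of non-negative integers $m_n=o(n)$ and every $\varepsilon>0$, with probability tending to $1$ as $n\to\infty$, there is no set $S$ of at most $m_n$ sensors (possibly chosen with knowledge of all key rings) for which the sensors outside $S$ can be partitioned into two sets $A,B$, each of size at least $\varepsilon n$, such that for every secure link between $A$ and $B$ all keys shared by its two end points are compromised (in particular, $A$ and $B$ isolated from each other is excluded). 2. For every sequence of non-negative integers $m_n=o(n)$ there is a sequence $\ell_n=o(n)$ such that, with probability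 tending to $1$ as $n\to\infty$, for every set $S$ of at most $m_n$ captured sensors there are at least $n-\ell_n$ non-captured sensors that form a connected graph when two distinct sensors are joined iff they share at least $q$ non-compromised keys. -/

import Mathlib

open Filter Topology MeasureTheory ProbabilityTheory Asymptotics

/-- A key ring: a set of exactly `K` distinct keys from the key pool `Fin P`. -/
def KeyRing (P K : ℕ) : Type := {s : Finset (Fin P) // s.card = K}

namespace KeyRing

/-- The set of keys of a key ring. -/
def keys {P K : ℕ} (r : KeyRing P K) : Finset (Fin P) := r.1

/-- Every set of key rings is an event. -/
instance instMeasurableSpace (P K : ℕ) : MeasurableSpace (KeyRing P K) := ⊤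

end KeyRing

/-- The outcome of key predistribution: a key ring for each of the `n` sensors. -/
abbrev KeyAssignment (n P K : ℕ) : Type := Fin n → KeyRing P K

/-- The law of the key assignment: the key rings of the `n` sensors are independent, and each is
uniformly distributed among all `K`-element subsets of the key pool. -/
noncomputable def keyLaw (n P K : ℕ) : Measure (KeyAssignment n P K) :=
  Measure.pi fun _ => uniformOn (Set.univ : Set (KeyRing P K))

/-- A sequence of events on the key assignments (one for each number `n` of sensors) holds with
high probability if its probability tends to `1` as `n → ∞`. -/
def WithHighProbability (K P : ℕ → ℕ) (E : ∀ n, KeyAssignment n (P n) (K n) → Prop) : Prop :=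
  Tendsto (fun n => keyLaw n (P n) (K n) {R | E n R}) atTop (𝓝 1)

section Network

variable {n P K : ℕ}

/-- The keys shared by sensors `i` and `j`. -/
def sharedKeys (R : KeyAssignment n P K) (i j : Fin n) : Finset (Fin P) :=
  (R i).keys ∩ (R j).keys

/-- The secure sensor network with the `q`-composite scheme under full visibility: two distinct
sensors have a secure link iff they share at least `q` keys. -/
def network (q : ℕ) (R : KeyAssignment n P K) : SimpleGraph (Fin n) where
  Adj i j := i ≠ j ∧ q ≤ (sharedKeys R i j).card
  symm := ⟨fun i j h => ⟨h.1.symm, by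
    have e : sharedKeys R j i = sharedKeys R i j := Finset.inter_comm _ _
    rw [e]; exact h.2⟩⟩
  loopless := ⟨fun _ h => h.1 rfl⟩

/-- The keys compromised by the capture of the set `S` of sensors: all keys in their rings. -/
def compromisedKeys (R : KeyAssignment n P K) (S : Finset (Fin n)) : Finset (Fin P) :=
  S.biUnion fun i => (R i).keys

/-- The network formed by the `q`-composite scheme when only keys that are not compromised by the
capture of `S` are used: two distinct sensors are linked iff they share at least `q`
non-compromised keys. -/
def uncompromisedNetwork (q : ℕ) (R : KeyAssignment n P K) (S : Finset (Fin n)) :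
    SimpleGraph (Fin n) where
  Adj i j := i ≠ j ∧ q ≤ (sharedKeys R i j \ compromisedKeys R S).card
  symm := ⟨fun i j h => ⟨h.1.symm, by
    have e : sharedKeys R j i = sharedKeys R i j := Finset.inter_comm _ _
    rw [e]; exact h.2⟩⟩
  loopless := ⟨fun _ h => h.1 rfl⟩

/-- The capture of `S` splits the network into the chunks `A` and `B`: these partition the
non-captured sensors, and they are isolated from each other or all keys used by the secure links
between them are compromised (isolation is the case where there are no such links). -/
def SplitsInto (q : ℕ) (R : KeyAssignment n P K) (S A B : Finset (Fin n)) : Prop :=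
  Disjoint A B ∧ A ∪ B = Sᶜ ∧
    ∀ a ∈ A, ∀ b ∈ B, (network q R).Adj a b → sharedKeys R a b ⊆ compromisedKeys R S

end Network

/-- Unsplittability: for every bound `m n = o(n)` on the number of captured sensors and every
`ε > 0`, with high probability no capture of a set of at most `m n` sensors (the set may depend on
the key assignment) splits the network into two chunks of at least `ε n` sensors each. -/
def Unsplittable (q : ℕ) (K P : ℕ → ℕ) : Prop :=
  ∀ m : ℕ → ℕ, (fun n => (m n : ℝ)) =o[atTop] (fun n : ℕ => (n : ℝ)) →
    ∀ ε : ℝ, 0 < ε →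
      WithHighProbability K P fun n R =>
        ¬ ∃ S A B : Finset (Fin n), S.card ≤ m n ∧ SplitsInto q R S A B ∧
          ε * n ≤ A.card ∧ ε * n ≤ B.card

/-- For every bound `m n = o(n)` on the number of captured sensors there is `ℓ n = o(n)` such that
with high probability, for every set `S` of at most `m n` captured sensors, at least `n - ℓ n`
non-captured sensors form a connected graph by means of non-compromised keys only. -/
def RemainsSecurelyConnected (q : ℕ) (K P : ℕ → ℕ) : Prop :=
  ∀ m : ℕ → ℕ, (fun n => (m n : ℝ)) =o[atTop] (fun n : ℕ => (n : ℝ)) →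
    ∃ ℓ : ℕ → ℝ, ℓ =o[atTop] (fun n : ℕ => (n : ℝ)) ∧
      WithHighProbability K P fun n R =>
        ∀ S : Finset (Fin n), S.card ≤ m n →
          ∃ T : Finset (Fin n), Disjoint T S ∧ (n : ℝ) - ℓ n ≤ T.card ∧
            ((uncompromisedNetwork q R S).induce (T : Set (Fin n))).Connected

/-! It suffices to link any two disjoint sets `A`, `B` of at least `ε n` sensors by a pair sharing
`q` keys that no sensor outside `A ∪ B` holds: capturing sensors outside `A ∪ B` cannot compromise
such a link.

Since `n K / P → 0`, most sensors have at least `K / 2` private keys, i.e. keys that no other sensor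
holds. Fix `A` and `B`, and reveal the key rings outside `B`. The keys private to the sensors of `A`
among the revealed rings form disjoint blocks, so by the second moment method the ring of one sensor
of `B` contains `q` keys of some block with probability close to `1`, because `n K ^ (2 q) / P ^ q`
tends to infinity. The rings of the at least `ε n` sensors of `B` are independent, which gives a
failure probability small enough for a union bound over the `4 ^ n` pairs `(A, B)`.

Once large sets are linked, deleting `o(n)` sensors leaves a component of size `n - o(n)`. -/

open scoped Finset

section Moments

variable {Ω ι : Type*} [MeasurableSpace Ω] {μ : Measure Ω} {s : Finset ι} {E : ι → Set Ω}

lemma mul_measureReal_le_card_le_sum [IsFiniteMeasure μ] [∀ ω, DecidablePred (ω ∈ E ·)]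
    (hE : ∀ i ∈ s, MeasurableSet (E i)) (c : ℝ) :
    c * μ.real {ω | c ≤ #{i ∈ s | ω ∈ E i}} ≤ ∑ i ∈ s, μ.real (E i) := by
  have hcount (ω : Ω) : (#{i ∈ s | ω ∈ E i} : ℝ) = ∑ i ∈ s, (E i).indicator 1 ω := by
    simp [Set.indicator_apply]
  have hint : ∀ i ∈ s, Integrable ((E i).indicator (1 : Ω → ℝ)) μ := fun i hi =>
    (integrable_const 1).indicator (hE i hi)
  calc c * μ.real {ω | c ≤ #{i ∈ s | ω ∈ E i}}
      = c * μ.real {ω | c ≤ ∑ i ∈ s, (E i).indicator 1 ω} := by simp_rw [hcount]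
    _ ≤ ∫ ω, ∑ i ∈ s, (E i).indicator 1 ω ∂μ :=
        mul_meas_ge_le_integral_of_nonneg
          (Eventually.of_forall fun ω => Finset.sum_nonneg fun i _ =>
            Set.indicator_nonneg (fun _ _ => zero_le_one) ω)
          (integrable_finsetSum s hint) c
    _ = ∑ i ∈ s, μ.real (E i) := by
        rw [integral_finsetSum s hint]
        exact Finset.sum_congr rfl fun i hi => integral_indicator_one (hE i hi)

lemma measureReal_iInter_compl_mul_sq_le [IsProbabilityMeasure μ]
    (hE : ∀ i ∈ s, MeasurableSet (E i)) :
    μ.real (⋂ i ∈ s, (E i)ᶜ) * (∑ i ∈ s, μ.real (E i)) ^ 2 ≤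
      ∑ i ∈ s, ∑ j ∈ s, (μ.real (E i ∩ E j) - μ.real (E i) * μ.real (E j)) := by
  set X : ι → Ω → ℝ := fun i => (E i).indicator 1
  set m := ∑ i ∈ s, μ.real (E i)
  have hX : ∀ i ∈ s, MemLp (X i) 2 μ := fun i hi => (memLp_const 1).indicator (hE i hi)
  have hmean : ∀ i ∈ s, μ[X i] = μ.real (E i) := fun i hi => integral_indicator_one (hE i hi)
  have hsum : MemLp (fun ω => ∑ i ∈ s, X i ω) 2 μ := memLp_finsetSum s hX
  have hm : ∫ ω, ∑ i ∈ s, X i ω ∂μ = m := by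
    rw [integral_finsetSum s fun i hi => (hX i hi).integrable one_le_two]
    exact Finset.sum_congr rfl hmean
  have hcov : ∀ i ∈ s, ∀ j ∈ s,
      cov[X i, X j; μ] = μ.real (E i ∩ E j) - μ.real (E i) * μ.real (E j) := by
    intro i hi j hj
    rw [covariance_eq_sub (hX i hi) (hX j hj), hmean i hi, hmean j hj,
      ← integral_indicator_one ((hE i hi).inter (hE j hj)), Set.inter_indicator_one]
  have hsub : ⋂ i ∈ s, (E i)ᶜ ⊆ {ω | m ^ 2 ≤ (∑ i ∈ s, X i ω - m) ^ 2} := by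
    intro ω hω
    have hzero : ∑ i ∈ s, X i ω = 0 := Finset.sum_eq_zero fun i hi =>
      Set.indicator_of_notMem (Set.mem_iInter₂.1 hω i hi) _
    simp [hzero]
  calc μ.real (⋂ i ∈ s, (E i)ᶜ) * m ^ 2
      ≤ m ^ 2 * μ.real {ω | m ^ 2 ≤ (∑ i ∈ s, X i ω - m) ^ 2} := by
        rw [mul_comm]
        exact mul_le_mul_of_nonneg_left (measureReal_mono hsub) (sq_nonneg m)
    _ ≤ ∫ ω, (∑ i ∈ s, X i ω - m) ^ 2 ∂μ :=
        mul_meas_ge_le_integral_of_nonneg (Eventually.of_forall fun _ => sq_nonneg _)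
          (hsum.sub (memLp_const m)).integrable_sq _
    _ = Var[fun ω => ∑ i ∈ s, X i ω; μ] := by
        rw [variance_eq_integral hsum.aemeasurable, hm]
    _ = ∑ i ∈ s, ∑ j ∈ s, (μ.real (E i ∩ E j) - μ.real (E i) * μ.real (E j)) := by
        rw [variance_fun_sum' hX]
        exact Finset.sum_congr rfl fun i hi => Finset.sum_congr rfl fun j hj => hcov i hi j hj

lemma measureReal_iInter_compl_mul_sum_le [IsProbabilityMeasure μ]
    (hE : ∀ i ∈ s, MeasurableSet (E i)) (r : ι → ι → Prop) [DecidableRel r]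
    (hneg : ∀ i ∈ s, ∀ j ∈ s, ¬ r i j → μ.real (E i ∩ E j) ≤ μ.real (E i) * μ.real (E j))
    {Δ : ℝ} (hΔ : 0 ≤ Δ)
    (hr : ∀ i ∈ s, ∑ j ∈ s with r i j, μ.real (E i ∩ E j) ≤ Δ * μ.real (E i)) :
    μ.real (⋂ i ∈ s, (E i)ᶜ) * ∑ i ∈ s, μ.real (E i) ≤ Δ := by
  set m := ∑ i ∈ s, μ.real (E i)
  have hrow : ∀ i ∈ s,
      ∑ j ∈ s, (μ.real (E i ∩ E j) - μ.real (E i) * μ.real (E j)) ≤ Δ * μ.real (E i) := by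
    intro i hi
    refine le_trans ?_ (hr i hi)
    rw [Finset.sum_filter]
    refine Finset.sum_le_sum fun j hj => ?_
    split_ifs with hij
    · exact sub_le_self _ (by positivity)
    · exact sub_nonpos.2 (hneg i hi j hj hij)
  have hsq : μ.real (⋂ i ∈ s, (E i)ᶜ) * m ^ 2 ≤ Δ * m := by
    refine (measureReal_iInter_compl_mul_sq_le hE).trans ((Finset.sum_le_sum hrow).trans_eq ?_)
    rw [← Finset.mul_sum]
  have hm0 : 0 ≤ m := Finset.sum_nonneg fun i _ => measureReal_nonneg
  rcases hm0.eq_or_lt with h0 | hpos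
  · rw [← h0, mul_zero]
    exact hΔ
  · refine le_of_mul_le_mul_right ?_ hpos
    rwa [mul_assoc, ← sq]

end Moments

-- Given the coordinates outside `B`, the sets `G R i` are fixed, so the events `R i ∈ G R i` are
-- independent over `i ∈ B`.
lemma measure_pi_le_pow_card {ι : Type*} {Ω : ι → Type*} [Fintype ι]
    [∀ i, MeasurableSpace (Ω i)] (μ : ∀ i, Measure (Ω i)) [∀ i, IsProbabilityMeasure (μ i)]
    {B : Finset ι} {E : Set (∀ i, Ω i)} (hE : MeasurableSet E)
    {G : (∀ i, Ω i) → ∀ i, Set (Ω i)} (hG : DependsOn G (B : Set ι)ᶜ)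
    (hEG : ∀ R ∈ E, ∀ i ∈ B, R i ∈ G R i) {η : ENNReal}
    (hη : ∀ R ∈ E, ∀ i ∈ B, μ i (G R i) ≤ η) :
    Measure.pi μ E ≤ η ^ #B := by
  classical
  set e := MeasurableEquiv.piEquivPiSubtypeProd Ω (· ∉ B)
  have hmp := (measurePreserving_piEquivPiSubtypeProd μ (· ∉ B)).symm
  have hsection (x : ∀ i : {i // i ∉ B}, Ω i) :
      (Measure.pi fun i : {i // ¬ i ∉ B} => μ i) (Prod.mk x ⁻¹' (e.symm ⁻¹' E)) ≤ η ^ #B := by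
    rcases Set.eq_empty_or_nonempty (Prod.mk x ⁻¹' (e.symm ⁻¹' E)) with hempty | ⟨y₀, hy₀⟩
    · simp [hempty]
    have hsub : Prod.mk x ⁻¹' (e.symm ⁻¹' E) ⊆
        Set.univ.pi fun i : {i // ¬ i ∉ B} => G (e.symm (x, y₀)) i := by
      intro y hy i _
      have hcoord : e.symm (x, y) i = y i := dif_neg i.2
      have hoff (z) (j : ι) (hj : j ∉ B) : e.symm (x, z) j = x ⟨j, hj⟩ := dif_pos hj
      have hagree : G (e.symm (x, y₀)) = G (e.symm (x, y)) := hG fun j hj => by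
        rw [hoff y₀ j hj, hoff y j hj]
      rw [← hcoord, hagree]
      exact hEG _ hy i (not_not.1 i.2)
    calc (Measure.pi fun i : {i // ¬ i ∉ B} => μ i) (Prod.mk x ⁻¹' (e.symm ⁻¹' E))
        ≤ ∏ i : {i // ¬ i ∉ B}, μ i (G (e.symm (x, y₀)) i) :=
          (measure_mono hsub).trans_eq (Measure.pi_pi _ _)
      _ ≤ ∏ _i : {i // ¬ i ∉ B}, η :=
          Finset.prod_le_prod' fun i _ => hη _ hy₀ i (not_not.1 i.2)
      _ = η ^ #B := by simp
  calc Measure.pi μ E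
      = ∫⁻ x, (Measure.pi fun i : {i // ¬ i ∉ B} => μ i) (Prod.mk x ⁻¹' (e.symm ⁻¹' E))
          ∂Measure.pi fun i : {i // i ∉ B} => μ i := by
        rw [← hmp.measure_preimage hE.nullMeasurableSet,
          Measure.prod_apply (hmp.measurable hE)]
    _ ≤ η ^ #B := (lintegral_mono hsection).trans_eq (by simp)

lemma measureReal_pi_le_pow_card {ι : Type*} {Ω : ι → Type*} [Fintype ι]
    [∀ i, MeasurableSpace (Ω i)] (μ : ∀ i, Measure (Ω i)) [∀ i, IsProbabilityMeasure (μ i)]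
    {B : Finset ι} {E : Set (∀ i, Ω i)} (hE : MeasurableSet E)
    {G : (∀ i, Ω i) → ∀ i, Set (Ω i)} (hG : DependsOn G (B : Set ι)ᶜ)
    (hEG : ∀ R ∈ E, ∀ i ∈ B, R i ∈ G R i) {η : ℝ} (hη0 : 0 ≤ η)
    (hη : ∀ R ∈ E, ∀ i ∈ B, (μ i).real (G R i) ≤ η) :
    (Measure.pi μ).real E ≤ η ^ #B := by
  refine ENNReal.toReal_le_of_le_ofReal (pow_nonneg hη0 _) ?_
  rw [ENNReal.ofReal_pow hη0]
  refine measure_pi_le_pow_card μ hE hG hEG fun R hR i hi => ?_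
  rw [← ofReal_measureReal]
  exact ENNReal.ofReal_le_ofReal (hη R hR i hi)

lemma sum_powerset_pow_card_sdiff {α R : Type*} [DecidableEq α] [CommSemiring R]
    (D T : Finset α) (x : R) :
    ∑ S ∈ D.powerset, x ^ #(S \ T) = 2 ^ #(D ∩ T) * (1 + x) ^ #(D \ T) := by
  have hterm (S : Finset α) : x ^ #(S \ T) = ∏ i ∈ S, if i ∈ T then 1 else x := by
    rw [Finset.prod_ite, Finset.prod_const_one, one_mul, Finset.prod_const,
      Finset.filter_notMem_eq_sdiff]
  have hfactor (i : α) : (1 + if i ∈ T then 1 else x) = if i ∈ T then 2 else 1 + x := by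
    split_ifs <;> norm_num
  simp_rw [hterm]
  rw [← Finset.prod_one_add]
  simp_rw [hfactor]
  rw [Finset.prod_ite, Finset.prod_const, Finset.prod_const, Finset.filter_mem_eq_inter,
    Finset.filter_notMem_eq_sdiff]

lemma exists_tendsto_atTop_eventually {p : ℕ → ℕ → Prop} (hp : ∀ k, ∀ᶠ n in atTop, p k n) :
    ∃ φ : ℕ → ℕ, Tendsto φ atTop atTop ∧ ∀ᶠ n in atTop, p (φ n) n := by
  classical
  refine ⟨fun n => Nat.findGreatest (p · n) n, tendsto_atTop.2 fun k => ?_, ?_⟩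
  · filter_upwards [hp k, eventually_ge_atTop k] with n hn hk using Nat.le_findGreatest hk hn
  · filter_upwards [hp 0] with n hn using Nat.findGreatest_spec (P := (p · n)) n.zero_le hn

section Graph

variable {V : Type*} (G : SimpleGraph V)

lemma induce_connected_of_forall_exists_adj {U : Finset V} (hU : U.Nonempty)
    (hcut : ∀ X ⊂ U, X.Nonempty → ∃ x ∈ X, ∃ y ∈ U, y ∉ X ∧ G.Adj x y) :
    (G.induce (U : Set V)).Connected := by
  classical
  obtain ⟨u, hu⟩ := hU
  rw [SimpleGraph.connected_iff_exists_forall_reachable]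
  refine ⟨⟨u, hu⟩, ?_⟩
  let X : Finset V := {x ∈ U | ∃ hx : x ∈ U, (G.induce (U : Set V)).Reachable ⟨u, hu⟩ ⟨x, hx⟩}
  have huX : u ∈ X := Finset.mem_filter.2 ⟨hu, hu, .rfl⟩
  suffices hXU : X = U by
    rintro ⟨v, hv⟩
    rw [Finset.mem_coe, ← hXU] at hv
    exact (Finset.mem_filter.1 hv).2.2
  by_contra hne
  obtain ⟨x, hx, y, hyU, hyX, hxy⟩ :=
    hcut X ((Finset.filter_subset _ _).ssubset_of_ne hne) ⟨u, huX⟩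
  obtain ⟨-, hxU, hreach⟩ := Finset.mem_filter.1 hx
  have hadj : (G.induce (U : Set V)).Adj ⟨x, hxU⟩ ⟨y, hyU⟩ := hxy
  exact hyX (Finset.mem_filter.2 ⟨hyU, hyU, hreach.trans hadj.reachable⟩)

lemma exists_induce_connected_of_large_linked {W : Finset V} {e : ℝ} (he : 0 < e)
    (hW : 3 * e ≤ #W)
    (hlinked : ∀ A ⊆ W, ∀ B ⊆ W, Disjoint A B → e ≤ #A → e ≤ #B → ∃ a ∈ A, ∃ b ∈ B, G.Adj a b) :
    ∃ T ⊆ W, (#W : ℝ) - e ≤ #T ∧ (G.induce (T : Set V)).Connected := by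
  classical
  -- A minimal separated set `U` of size at least `e` has more than `2 e` vertices, while a cut of
  -- `U` without edges would leave two separated sets, both smaller than `e`.
  let Separated (U : Finset V) : Prop := U ⊆ W ∧ ∀ u ∈ U, ∀ w ∈ W \ U, ¬ G.Adj u w
  have hcard {X Y : Finset V} (h : X ⊆ Y) : (#(Y \ X) : ℝ) + #X = #Y := by
    exact_mod_cast Finset.card_sdiff_add_card_eq_card h
  have hWsep : Separated W := ⟨subset_rfl, by simp⟩
  obtain ⟨U, ⟨⟨hUW, hUsep⟩, heU⟩, hmin⟩ := exists_minimal_of_wellFoundedLT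
    (fun U => Separated U ∧ e ≤ #U) ⟨W, hWsep, by linarith⟩
  have hlarge : #W - e < #U := by
    by_contra! hle
    obtain ⟨a, ha, b, hb, hab⟩ := hlinked U hUW (W \ U) Finset.sdiff_subset
      Finset.disjoint_sdiff heU (by linarith [hcard hUW])
    exact hUsep a ha b hb hab
  have hsmall : ∀ X ⊂ U, Separated X → #X < e := fun X hXU hX => by
    by_contra! heX
    exact hXU.not_subset (hmin ⟨hX, heX⟩ hXU.subset)
  refine ⟨U, hUW, hlarge.le, induce_connected_of_forall_exists_adj G ?_ fun X hXU hX => ?_⟩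
  · exact Finset.card_pos.1 (by exact_mod_cast he.trans_le heU)
  by_contra! hcut
  have hXsep : Separated X := ⟨hXU.subset.trans hUW, fun x hx w hw hxw => by
    obtain ⟨hwW, hwX⟩ := Finset.mem_sdiff.1 hw
    by_cases hwU : w ∈ U
    · exact hcut x hx w hwU hwX hxw
    · exact hUsep x (hXU.subset hx) w (Finset.mem_sdiff.2 ⟨hwW, hwU⟩) hxw⟩
  have hdiffsep : Separated (U \ X) := ⟨Finset.sdiff_subset.trans hUW, fun y hy w hw hyw => by
    obtain ⟨hyU, hyX⟩ := Finset.mem_sdiff.1 hy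
    by_cases hwX : w ∈ X
    · exact hcut w hwX y hyU hyX hyw.symm
    · refine hUsep y hyU w ?_ hyw
      simp only [Finset.mem_sdiff] at hw ⊢
      tauto⟩
  linarith [hcard hXU.subset, hsmall X hXU hXsep,
    hsmall (U \ X) (Finset.sdiff_ssubset hXU.subset hX) hdiffsep]

end Graph

/-- `(K)_t / (P)_t`, the probability that a uniformly random `K`-element subset of a pool of `P`
keys contains `t` given keys. -/
noncomputable def inclusionProb (P K t : ℕ) : ℝ :=
  (K.descFactorial t : ℝ) / P.descFactorial t

section InclusionProb

variable {P K : ℕ}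

lemma inclusionProb_eq_prod (t : ℕ) :
    inclusionProb P K t = ∏ i ∈ Finset.range t, ((K - i : ℕ) : ℝ) / (P - i : ℕ) := by
  simp only [inclusionProb, Nat.descFactorial_eq_prod_range, Nat.cast_prod, Finset.prod_div_distrib]

lemma antitone_natSub_div_natSub (hKP : K ≤ P) :
    Antitone fun i : ℕ => ((K - i : ℕ) : ℝ) / (P - i : ℕ) := by
  intro i j hij
  rcases le_or_gt K j with hKj | hjK
  · simp only [Nat.sub_eq_zero_of_le hKj, Nat.cast_zero, zero_div]
    positivity
  have hji : (i : ℝ) ≤ j := by exact_mod_cast hij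
  have hKj : (j : ℝ) < K := by exact_mod_cast hjK
  have hPK : (K : ℝ) ≤ P := by exact_mod_cast hKP
  simp only [Nat.cast_sub hjK.le, Nat.cast_sub (hij.trans hjK.le),
    Nat.cast_sub (hjK.le.trans hKP), Nat.cast_sub (hij.trans (hjK.le.trans hKP))]
  rw [div_le_div_iff₀ (by linarith) (by linarith)]
  nlinarith [mul_nonneg (sub_nonneg.2 hji) (sub_nonneg.2 hPK)]

lemma inclusionProb_add_le_mul (hKP : K ≤ P) (s t : ℕ) :
    inclusionProb P K (s + t) ≤ inclusionProb P K s * inclusionProb P K t := by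
  simp only [inclusionProb_eq_prod, Finset.prod_range_add]
  exact mul_le_mul_of_nonneg_left
    (Finset.prod_le_prod (fun _ _ => by positivity) fun i _ =>
      antitone_natSub_div_natSub hKP (Nat.le_add_left i s))
    (by positivity)

lemma inclusionProb_le_pow (hKP : K ≤ P) (t : ℕ) : inclusionProb P K t ≤ ((K : ℝ) / P) ^ t := by
  rw [inclusionProb_eq_prod, Finset.pow_eq_prod_const]
  exact Finset.prod_le_prod (fun _ _ => by positivity) fun i _ => by
    simpa only [Nat.sub_zero] using antitone_natSub_div_natSub hKP i.zero_le

lemma pow_le_inclusionProb (hKP : K ≤ P) (t : ℕ) :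
    (((K - t : ℕ) : ℝ) / P) ^ t ≤ inclusionProb P K t := by
  rw [inclusionProb_eq_prod, Finset.pow_eq_prod_const]
  refine Finset.prod_le_prod (fun _ _ => by positivity) fun i hi => ?_
  have hit := (Finset.mem_range.1 hi).le
  rcases le_or_gt K i with hKi | hiK
  · simp only [Nat.sub_eq_zero_of_le (hKi.trans hit), Nat.cast_zero, zero_div]
    positivity
  · have hP : 0 < P - i := by omega
    gcongr
    exact P.sub_le i

end InclusionProb

namespace KeyRing

variable {P K : ℕ}

noncomputable instance instFintype (P K : ℕ) : Fintype (KeyRing P K) :=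
  inferInstanceAs (Fintype {s : Finset (Fin P) // s.card = K})

/-- The law of the key ring of a single sensor: uniform on the `K`-element subsets of the pool. -/
noncomputable abbrev law (P K : ℕ) : Measure (KeyRing P K) :=
  uniformOn Set.univ

lemma card_keys (r : KeyRing P K) : #r.keys = K := r.2

lemma nonempty_of_le (hKP : K ≤ P) : Nonempty (KeyRing P K) := by
  obtain ⟨s, -, hs⟩ := Finset.exists_subset_card_eq (s := (Finset.univ : Finset (Fin P))) (n := K)
    (by simpa only [Finset.card_univ, Fintype.card_fin] using hKP)
  exact ⟨⟨s, hs⟩⟩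

lemma isProbabilityMeasure_law (hKP : K ≤ P) : IsProbabilityMeasure (law P K) := by
  have := nonempty_of_le hKP
  infer_instance

lemma card_filter_keys (p : Finset (Fin P) → Prop) [DecidablePred p] :
    #{r : KeyRing P K | p r.keys} = #{s ∈ (Finset.univ : Finset (Fin P)).powersetCard K | p s} := by
  refine Finset.card_bij (fun r _ => r.keys) (fun r hr => ?_) (fun _ _ _ _ => Subtype.ext)
    fun s hs => ?_
  · simpa [r.card_keys] using hr
  · simp only [Finset.mem_filter, Finset.mem_powersetCard] at hs
    exact ⟨⟨s, hs.1.2⟩, Finset.mem_filter.2 ⟨Finset.mem_univ _, hs.2⟩, rfl⟩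

lemma card_keyRing : Fintype.card (KeyRing P K) = P.choose K := by
  simpa using card_filter_keys (P := P) (K := K) fun _ => True

lemma law_real_eq (p : Finset (Fin P) → Prop) [DecidablePred p] :
    (law P K).real {r | p r.keys} =
      (#{s ∈ (Finset.univ : Finset (Fin P)).powersetCard K | p s} : ℝ) / P.choose K := by
  have hset : {r : KeyRing P K | p r.keys} = ({r | p r.keys} : Finset (KeyRing P K)) := by
    ext; simp
  rw [hset, measureReal_def, uniformOn_univ, Measure.count_apply_finset, card_filter_keys,
    card_keyRing, ENNReal.toReal_div, ENNReal.toReal_natCast, ENNReal.toReal_natCast]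

lemma law_real_superset (hKP : K ≤ P) (T : Finset (Fin P)) :
    (law P K).real {r | T ⊆ r.keys} = inclusionProb P K #T := by
  rcases lt_or_ge K #T with hlt | hle
  · have hempty : {r : KeyRing P K | T ⊆ r.keys} = ∅ := by
      ext r
      simpa using fun h => (Finset.card_le_card h).not_gt (r.card_keys.trans_lt hlt)
    rw [hempty, measureReal_empty, inclusionProb, Nat.descFactorial_of_lt hlt, Nat.cast_zero,
      zero_div]
  have hTP := hle.trans hKP
  have hchoose : ((P.choose K : ℕ) : ℝ) * K.choose #T = P.choose #T * (P - #T).choose (K - #T) := by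
    exact_mod_cast Nat.choose_mul hle
  have hpos : (0 : ℝ) < P.choose K := by exact_mod_cast Nat.choose_pos hKP
  have hpos' : (0 : ℝ) < P.choose #T := by exact_mod_cast Nat.choose_pos hTP
  rw [law_real_eq, Finset.card_filter_powersetCard_subset _ _ _ (Finset.subset_univ T) hle,
    Finset.card_univ, Fintype.card_fin, inclusionProb, Nat.descFactorial_eq_factorial_mul_choose,
    Nat.descFactorial_eq_factorial_mul_choose, Nat.cast_mul, Nat.cast_mul,
    mul_div_mul_left _ _ (by positivity), div_eq_div_iff hpos.ne' hpos'.ne', mul_comm, ← hchoose,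
    mul_comm]

lemma mul_law_real_le_card_inter_le (hKP : K ≤ P) (U : Finset (Fin P)) (t : ℝ) :
    t * (law P K).real {r | t ≤ #(r.keys ∩ U)} ≤ #U * ((K : ℝ) / P) := by
  have := isProbabilityMeasure_law hKP
  have hmean (u : Fin P) : (law P K).real {r | u ∈ r.keys} ≤ (K : ℝ) / P := by
    simpa only [Finset.singleton_subset_iff, Finset.card_singleton, pow_one] using
      (law_real_superset hKP {u}).trans_le (inclusionProb_le_pow hKP 1)
  have hmarkov := mul_measureReal_le_card_le_sum (μ := law P K) (s := U)
    (E := fun u => {r | u ∈ r.keys}) (fun _ _ => trivial) t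
  simp only [Set.mem_ofPred_eq, Finset.filter_mem_eq_inter] at hmarkov
  simp only [Finset.inter_comm _ U]
  calc t * (law P K).real {r | t ≤ #(U ∩ r.keys)}
      ≤ ∑ u ∈ U, (law P K).real {r | u ∈ r.keys} := hmarkov
    _ ≤ #U * ((K : ℝ) / P) := by
      simpa only [nsmul_eq_mul] using Finset.sum_le_card_nsmul U _ _ fun u _ => hmean u

lemma law_real_inter_le (hKP : K ≤ P) (T S : Finset (Fin P)) :
    (law P K).real ({r | T ⊆ r.keys} ∩ {r | S ⊆ r.keys}) ≤
      (law P K).real {r | T ⊆ r.keys} * inclusionProb P K #(S \ T) := by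
  have hunion : {r : KeyRing P K | T ⊆ r.keys} ∩ {r | S ⊆ r.keys} = {r | T ∪ S ⊆ r.keys} := by
    ext r
    simp [Finset.union_subset_iff]
  have hcard : #(T ∪ S) = #T + #(S \ T) := by
    rw [← Finset.union_sdiff_self_eq_union, Finset.card_union_of_disjoint Finset.disjoint_sdiff]
  rw [hunion, law_real_superset hKP, law_real_superset hKP, hcard]
  exact inclusionProb_add_le_mul hKP _ _

lemma law_real_inter_le_mul_of_disjoint (hKP : K ≤ P) {T S : Finset (Fin P)} (h : Disjoint T S) :
    (law P K).real ({r | T ⊆ r.keys} ∩ {r | S ⊆ r.keys}) ≤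
      (law P K).real {r | T ⊆ r.keys} * (law P K).real {r | S ⊆ r.keys} := by
  simpa only [h.symm.sdiff_eq_left, law_real_superset hKP S] using law_real_inter_le hKP T S

lemma sum_powerset_law_real_inter_le (hKP : K ≤ P) {D T : Finset (Fin P)} (hTD : T ⊆ D) :
    ∑ S ∈ D.powerset, (law P K).real ({r | T ⊆ r.keys} ∩ {r | S ⊆ r.keys}) ≤
      2 ^ #T * (1 + (K : ℝ) / P) ^ #D * (law P K).real {r | T ⊆ r.keys} := by
  calc ∑ S ∈ D.powerset, (law P K).real ({r | T ⊆ r.keys} ∩ {r | S ⊆ r.keys})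
      ≤ ∑ S ∈ D.powerset, (law P K).real {r | T ⊆ r.keys} * ((K : ℝ) / P) ^ #(S \ T) :=
        Finset.sum_le_sum fun S _ => (law_real_inter_le hKP T S).trans
          (mul_le_mul_of_nonneg_left (inclusionProb_le_pow hKP _) measureReal_nonneg)
    _ = 2 ^ #T * (1 + (K : ℝ) / P) ^ #(D \ T) * (law P K).real {r | T ⊆ r.keys} := by
        rw [← Finset.mul_sum, sum_powerset_pow_card_sdiff, Finset.inter_eq_right.2 hTD, mul_comm]
    _ ≤ 2 ^ #T * (1 + (K : ℝ) / P) ^ #D * (law P K).real {r | T ⊆ r.keys} := by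
        gcongr
        · exact le_add_of_nonneg_right (by positivity)
        · exact Finset.sdiff_subset

lemma one_add_div_pow_le_exp_one (hK : K ^ 2 ≤ P) : (1 + (K : ℝ) / P) ^ K ≤ Real.exp 1 := by
  have hratio : (K : ℝ) * (K / P) ≤ 1 := by
    rw [← mul_div_assoc, ← sq]
    exact div_le_one_of_le₀ (by exact_mod_cast hK) (Nat.cast_nonneg P)
  calc (1 + (K : ℝ) / P) ^ K ≤ Real.exp ((K : ℝ) / P) ^ K := by
        gcongr
        rw [add_comm]
        exact Real.add_one_le_exp _
    _ = Real.exp (K * (K / P)) := (Real.exp_nat_mul _ _).symm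
    _ ≤ Real.exp 1 := Real.exp_le_exp.2 hratio

lemma sum_powersetCard_law_real_inter_le (hK : K ^ 2 ≤ P) {D T : Finset (Fin P)} (hTD : T ⊆ D)
    (hD : #D ≤ K) (q : ℕ) :
    ∑ S ∈ D.powersetCard q, (law P K).real ({r | T ⊆ r.keys} ∩ {r | S ⊆ r.keys}) ≤
      2 ^ #T * Real.exp 1 * (law P K).real {r | T ⊆ r.keys} := by
  have hKP : K ≤ P := (Nat.le_self_pow two_ne_zero K).trans hK
  have hbase : 1 ≤ 1 + (K : ℝ) / P := le_add_of_nonneg_right (by positivity)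
  calc ∑ S ∈ D.powersetCard q, (law P K).real ({r | T ⊆ r.keys} ∩ {r | S ⊆ r.keys})
      ≤ ∑ S ∈ D.powerset, (law P K).real ({r | T ⊆ r.keys} ∩ {r | S ⊆ r.keys}) :=
        Finset.sum_le_sum_of_subset_of_nonneg
          (fun _ hS => Finset.mem_powerset.2 (Finset.mem_powersetCard.1 hS).1)
          fun _ _ _ => measureReal_nonneg
    _ ≤ 2 ^ #T * (1 + (K : ℝ) / P) ^ #D * (law P K).real {r | T ⊆ r.keys} :=
        sum_powerset_law_real_inter_le hKP hTD
    _ ≤ 2 ^ #T * Real.exp 1 * (law P K).real {r | T ⊆ r.keys} := by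
        gcongr
        exact (pow_le_pow_right₀ hbase hD).trans (one_add_div_pow_le_exp_one hK)

-- Second moment method for the number of `q`-subsets of the sets `D a` contained in the key ring:
-- by disjointness, only subsets of the same `D a` can be positively correlated.
lemma law_real_forall_card_inter_lt_mul_le {ι : Type*} (q : ℕ) (hK : K ^ 2 ≤ P) {A : Finset ι}
    {D : ι → Finset (Fin P)} (hD : (A : Set ι).PairwiseDisjoint D) (hDK : ∀ a ∈ A, #(D a) ≤ K) :
    (law P K).real {r | ∀ a ∈ A, #(r.keys ∩ D a) < q} *
      ((∑ a ∈ A, (#(D a)).choose q : ℕ) * inclusionProb P K q) ≤ 2 ^ q * Real.exp 1 := by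
  classical
  have hKP : K ≤ P := (Nat.le_self_pow two_ne_zero K).trans hK
  have := isProbabilityMeasure_law hKP
  set F := A.sigma fun a => (D a).powersetCard q
  let E (j : Σ _ : ι, Finset (Fin P)) : Set (KeyRing P K) := {r | j.2 ⊆ r.keys}
  have hmem {j} (hj : j ∈ F) : j.1 ∈ A ∧ j.2 ⊆ D j.1 ∧ #j.2 = q := by
    simpa only [F, Finset.mem_sigma, Finset.mem_powersetCard] using hj
  have hsum : ∑ j ∈ F, (law P K).real (E j) =
      (∑ a ∈ A, (#(D a)).choose q : ℕ) * inclusionProb P K q := by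
    rw [Finset.sum_congr rfl fun j hj => by rw [law_real_superset hKP, (hmem hj).2.2],
      Finset.sum_const, nsmul_eq_mul, Finset.card_sigma]
    simp only [Finset.card_powersetCard]
  have hsub : {r : KeyRing P K | ∀ a ∈ A, #(r.keys ∩ D a) < q} ⊆ ⋂ j ∈ F, (E j)ᶜ := by
    refine fun r hr => Set.mem_iInter₂.2 fun j hj hjr => ?_
    obtain ⟨hA, hjD, hjq⟩ := hmem hj
    exact (hr j.1 hA).not_ge (hjq ▸ Finset.card_le_card (Finset.subset_inter hjr hjD))
  rw [← hsum]
  refine (mul_le_mul_of_nonneg_right (measureReal_mono hsub)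
    (Finset.sum_nonneg fun _ _ => measureReal_nonneg)).trans ?_
  refine measureReal_iInter_compl_mul_sum_le (fun _ _ => MeasurableSet.of_discrete)
    (fun i j => i.1 = j.1) (fun i hi j hj hij => ?_) (by positivity) fun i hi => ?_
  · obtain ⟨hA, hiD, -⟩ := hmem hi
    obtain ⟨hA', hjD, -⟩ := hmem hj
    exact law_real_inter_le_mul_of_disjoint hKP ((hD hA hA' hij).mono hiD hjD)
  · obtain ⟨hA, hiD, hiq⟩ := hmem hi
    calc ∑ j ∈ F with i.1 = j.1, (law P K).real (E i ∩ E j)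
        = ∑ S ∈ (D i.1).powersetCard q, (law P K).real (E i ∩ {r | S ⊆ r.keys}) := by
          rw [Finset.sum_filter, Finset.sum_sigma,
            Finset.sum_eq_single_of_mem i.1 hA fun b _ hb =>
              Finset.sum_eq_zero fun S _ => if_neg hb.symm]
          simp only [if_true, E]
      _ ≤ 2 ^ q * Real.exp 1 * (law P K).real (E i) :=
          hiq ▸ sum_powersetCard_law_real_inter_le hK hiD (hDK _ hA) _

end KeyRing

section Events

variable {n P K : ℕ}

lemma isProbabilityMeasure_keyLaw (hKP : K ≤ P) : IsProbabilityMeasure (keyLaw n P K) := by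
  have := KeyRing.isProbabilityMeasure_law hKP
  unfold keyLaw
  infer_instance

instance isFiniteMeasure_keyLaw : IsFiniteMeasure (keyLaw n P K) := by
  unfold keyLaw
  infer_instance

lemma measurableSet_keyAssignment (E : Set (KeyAssignment n P K)) : MeasurableSet E :=
  E.toFinite.measurableSet

lemma card_compromisedKeys_le (R : KeyAssignment n P K) (S : Finset (Fin n)) :
    #(compromisedKeys R S) ≤ #S * K :=
  Finset.card_biUnion_le_card_mul _ _ _ fun i _ => (R i).card_keys.le

lemma compromisedKeys_mono (R : KeyAssignment n P K) : Monotone (compromisedKeys R) :=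
  fun _ _ h => Finset.biUnion_subset_biUnion_of_subset_left _ h

lemma dependsOn_compromisedKeys (S : Finset (Fin n)) :
    DependsOn (fun R : KeyAssignment n P K => compromisedKeys R S) (S : Set (Fin n)) :=
  fun _ _ h => Finset.biUnion_congr rfl fun i hi => by rw [h i hi]

/-- The keys of sensor `a` that no other sensor of `I` holds. For `I` the set of all sensors these
are the private keys proper; smaller sets `I` leave the key rings outside `I` unexamined. -/
def privateKeys (R : KeyAssignment n P K) (I : Finset (Fin n)) (a : Fin n) : Finset (Fin P) :=
  (R a).keys \ compromisedKeys R (I.erase a)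

lemma privateKeys_anti (R : KeyAssignment n P K) {I J : Finset (Fin n)} (h : I ⊆ J) (a : Fin n) :
    privateKeys R J a ⊆ privateKeys R I a :=
  Finset.sdiff_subset_sdiff subset_rfl (compromisedKeys_mono R (Finset.erase_subset_erase a h))

lemma card_privateKeys_le (R : KeyAssignment n P K) (I : Finset (Fin n)) (a : Fin n) :
    #(privateKeys R I a) ≤ K :=
  (Finset.card_le_card Finset.sdiff_subset).trans (R a).card_keys.le

lemma pairwiseDisjoint_privateKeys (R : KeyAssignment n P K) (I : Finset (Fin n)) :
    (I : Set (Fin n)).PairwiseDisjoint (privateKeys R I) := by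
  refine fun a ha b _ hab => Finset.disjoint_left.2 fun k hka hkb => ?_
  exact (Finset.mem_sdiff.1 hkb).2
    (Finset.mem_biUnion.2 ⟨a, Finset.mem_erase.2 ⟨hab, ha⟩, (Finset.mem_sdiff.1 hka).1⟩)

lemma dependsOn_privateKeys {I : Finset (Fin n)} {a : Fin n} (ha : a ∈ I) :
    DependsOn (fun R : KeyAssignment n P K => privateKeys R I a) (I : Set (Fin n)) := by
  intro R R' h
  have herase : compromisedKeys R (I.erase a) = compromisedKeys R' (I.erase a) :=
    dependsOn_compromisedKeys _ fun i hi => h i (Finset.mem_of_mem_erase hi)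
  simp only [privateKeys, h a ha, herase]

/-- The sensors fewer than half of whose keys are held by no other sensor. They are few, and are
discarded before private keys are used. -/
def poorSensors (R : KeyAssignment n P K) : Finset (Fin n) :=
  {i | 2 * #(privateKeys R Finset.univ i) < K}

lemma mem_poorSensors {R : KeyAssignment n P K} {i : Fin n} :
    i ∈ poorSensors R ↔ 2 * #(privateKeys R Finset.univ i) < K :=
  Finset.mem_filter_univ i

lemma keyLaw_real_mem_poorSensors_le (hKP : K ≤ P) (i : Fin n) :
    (keyLaw n P K).real {R | i ∈ poorSensors R} ≤ 2 * (n * ((K : ℝ) / P)) := by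
  have := KeyRing.isProbabilityMeasure_law hKP
  let U (R : KeyAssignment n P K) : Finset (Fin P) := compromisedKeys R (Finset.univ.erase i)
  have hU (R : KeyAssignment n P K) : (#(U R) : ℝ) ≤ n * K := by
    have hcard : #(Finset.univ.erase i) ≤ n := (Finset.card_erase_le).trans_eq (by simp)
    exact_mod_cast (card_compromisedKeys_le R _).trans (Nat.mul_le_mul_right K hcard)
  have hpi := measureReal_pi_le_pow_card (fun _ : Fin n => KeyRing.law P K) (B := {i})
    (E := {R | i ∈ poorSensors R}) (measurableSet_keyAssignment _)
    (G := fun R _ => {r | (K : ℝ) / 2 ≤ #(r.keys ∩ U R)})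
    (η := 2 * (n * ((K : ℝ) / P))) ?_ ?_ (by positivity) ?_
  · rwa [Finset.card_singleton, pow_one] at hpi
  · intro R R' h
    have hUU : U R = U R' := dependsOn_compromisedKeys _ fun j hj => h j (by simpa using hj)
    simp only [hUU]
  · intro R hR j hj
    obtain rfl := Finset.mem_singleton.1 hj
    have hpoor : 2 * #((R j).keys \ U R) < K := mem_poorSensors.1 hR
    have hsplit := Finset.card_inter_add_card_sdiff (R j).keys (U R)
    rw [(R j).card_keys] at hsplit
    rw [Set.mem_ofPred_eq, div_le_iff₀ two_pos]
    exact_mod_cast (by omega : K ≤ #((R j).keys ∩ U R) * 2)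
  · intro R hR _ _
    have hK : (0 : ℝ) < K := by
      exact_mod_cast (Nat.zero_le _).trans_lt (mem_poorSensors.1 hR)
    refine le_of_mul_le_mul_left ?_ (half_pos hK)
    calc (K : ℝ) / 2 * (KeyRing.law P K).real {r | (K : ℝ) / 2 ≤ #(r.keys ∩ U R)}
        ≤ #(U R) * ((K : ℝ) / P) := KeyRing.mul_law_real_le_card_inter_le hKP _ _
      _ ≤ n * K * ((K : ℝ) / P) := mul_le_mul_of_nonneg_right (hU R) (by positivity)
      _ = (K : ℝ) / 2 * (2 * (n * ((K : ℝ) / P))) := by ring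

lemma mul_keyLaw_real_le_card_poorSensors_le (hKP : K ≤ P) (t : ℝ) :
    t * (keyLaw n P K).real {R | t ≤ #(poorSensors R)} ≤ n * (2 * (n * ((K : ℝ) / P))) := by
  have := isProbabilityMeasure_keyLaw (n := n) hKP
  have hmarkov := mul_measureReal_le_card_le_sum (μ := keyLaw n P K) (s := Finset.univ)
    (E := fun i => {R | i ∈ poorSensors R}) (fun _ _ => measurableSet_keyAssignment _) t
  simp only [Set.mem_ofPred_eq, Finset.filter_univ_mem] at hmarkov
  refine hmarkov.trans ?_
  simpa using Finset.sum_le_card_nsmul Finset.univ _ _ fun i _ =>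
    keyLaw_real_mem_poorSensors_le hKP i

/-- The sensors of `A` have many private keys with respect to the sensors outside `B`, but no
sensor of `B` holds `q` of those of a single sensor of `A`. -/
def NoPrivateLink (q : ℕ) (R : KeyAssignment n P K) (A B : Finset (Fin n)) : Prop :=
  (∀ a ∈ A, K ≤ 2 * #(privateKeys R Bᶜ a)) ∧
    ∀ b ∈ B, ∀ a ∈ A, #((R b).keys ∩ privateKeys R Bᶜ a) < q

lemma le_sum_choose_mul_inclusionProb {ι : Type*} {q : ℕ} (hqK : 4 * q ≤ K) (hKP : K ≤ P)
    {A : Finset ι} {d : ι → ℕ} (hd : ∀ a ∈ A, K ≤ 2 * d a) :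
    #A * (8⁻¹ ^ q * (1 / (q.factorial : ℝ) * ((K : ℝ) ^ (2 * q) / (P : ℝ) ^ q))) ≤
      (∑ a ∈ A, (d a).choose q : ℕ) * inclusionProb P K q := by
  have hchoose : ∀ a ∈ A, ((K : ℝ) / 4) ^ q / q.factorial ≤ ((d a).choose q : ℝ) := by
    intro a ha
    have hKd := hd a ha
    have hquarter : (K : ℝ) / 4 ≤ (d a + 1 - q : ℕ) := by
      rw [div_le_iff₀ four_pos]
      exact_mod_cast (by omega : K ≤ (d a + 1 - q) * 4)
    refine le_trans ?_ (Nat.pow_le_choose q _)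
    gcongr
  have hincl : ((K : ℝ) / 2 / P) ^ q ≤ inclusionProb P K q := by
    have hhalf : (K : ℝ) / 2 ≤ (K - q : ℕ) := by
      rw [div_le_iff₀ two_pos]
      exact_mod_cast (by omega : K ≤ (K - q) * 2)
    refine le_trans ?_ (pow_le_inclusionProb hKP q)
    gcongr
  have hpow : ((K : ℝ) / 4) ^ q * ((K : ℝ) / 2 / P) ^ q =
      8⁻¹ ^ q * ((K : ℝ) ^ (2 * q) / (P : ℝ) ^ q) := by
    rw [← mul_pow, pow_mul, ← div_pow, ← mul_pow]
    ring
  calc #A * (8⁻¹ ^ q * (1 / (q.factorial : ℝ) * ((K : ℝ) ^ (2 * q) / (P : ℝ) ^ q)))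
      = #A * (((K : ℝ) / 4) ^ q / q.factorial) * ((K : ℝ) / 2 / P) ^ q := by
        rw [mul_assoc, div_mul_eq_mul_div _ _ (_ ^ q), hpow]
        ring
    _ ≤ (∑ a ∈ A, (d a).choose q : ℕ) * inclusionProb P K q := by
        gcongr
        simpa using Finset.card_nsmul_le_sum A _ _ hchoose

lemma keyLaw_real_noPrivateLink_le {q : ℕ} (hqK : 4 * q ≤ K) (hK : K ^ 2 ≤ P)
    {A B : Finset (Fin n)} (hAB : Disjoint A B) {η : ℝ} (hη0 : 0 ≤ η)
    (hη : 2 ^ q * Real.exp 1 ≤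
      η * (#A * (8⁻¹ ^ q * (1 / (q.factorial : ℝ) * ((K : ℝ) ^ (2 * q) / (P : ℝ) ^ q))))) :
    (keyLaw n P K).real {R | NoPrivateLink q R A B} ≤ η ^ #B := by
  have hKP : K ≤ P := (Nat.le_self_pow two_ne_zero K).trans hK
  have := KeyRing.isProbabilityMeasure_law hKP
  have hABc : A ⊆ Bᶜ := Finset.subset_compl_iff_disjoint_right.2 hAB
  refine measureReal_pi_le_pow_card (fun _ => KeyRing.law P K) (measurableSet_keyAssignment _)
    (G := fun R _ => {r | ∀ a ∈ A, #(r.keys ∩ privateKeys R Bᶜ a) < q})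
    (fun R R' h => ?_) (fun R hR => hR.2) hη0 fun R hR _ _ => ?_
  · have hpriv : ∀ a ∈ A, privateKeys R Bᶜ a = privateKeys R' Bᶜ a := fun a ha =>
      dependsOn_privateKeys (hABc ha) (by simpa using h)
    funext _
    ext r
    exact forall₂_congr fun a ha => by rw [hpriv a ha]
  · set N := ((∑ a ∈ A, (#(privateKeys R Bᶜ a)).choose q : ℕ) : ℝ) * inclusionProb P K q
    have hN : 2 ^ q * Real.exp 1 ≤ η * N :=
      hη.trans (mul_le_mul_of_nonneg_left (le_sum_choose_mul_inclusionProb hqK hKP hR.1) hη0)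
    have hNpos : 0 < N :=
      pos_of_mul_pos_right (lt_of_lt_of_le (by positivity) hN) hη0
    refine le_of_mul_le_mul_right (le_trans ?_ hN) hNpos
    exact KeyRing.law_real_forall_card_inter_lt_mul_le q hK
      ((pairwiseDisjoint_privateKeys R Bᶜ).subset (by exact_mod_cast hABc))
      fun a _ => card_privateKeys_le R _ a

end Events

section Chunks

variable {n P K q : ℕ} {ε : ℝ} {R : KeyAssignment n P K}

/-- Any two disjoint sets of at least `ε n` sensors contain a pair of sensors sharing `q` keys which
no sensor outside the two sets holds. -/
def LargeChunksLinked (q : ℕ) (ε : ℝ) (R : KeyAssignment n P K) : Prop :=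
  ∀ A B : Finset (Fin n), Disjoint A B → ε * n ≤ #A → ε * n ≤ #B →
    ∃ a ∈ A, ∃ b ∈ B, q ≤ #(sharedKeys R a b \ compromisedKeys R (A ∪ B)ᶜ)

lemma inter_privateKeys_compl_subset {A B : Finset (Fin n)} {a : Fin n} (ha : a ∈ A) (b : Fin n) :
    (R b).keys ∩ privateKeys R Bᶜ a ⊆ sharedKeys R a b \ compromisedKeys R (A ∪ B)ᶜ := by
  intro k hk
  rw [Finset.mem_inter, privateKeys, Finset.mem_sdiff] at hk
  obtain ⟨hkb, hka, hkB⟩ := hk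
  refine Finset.mem_sdiff.2 ⟨Finset.mem_inter.2 ⟨hka, hkb⟩, fun hkAB => hkB ?_⟩
  refine compromisedKeys_mono R (fun i hi => ?_) hkAB
  simp only [Finset.mem_compl, Finset.mem_union, not_or, Finset.mem_erase] at hi ⊢
  exact ⟨fun hia => hi.1 (hia ▸ ha), hi.2⟩

lemma exists_noPrivateLink_of_not_largeChunksLinked (h : ¬ LargeChunksLinked q ε R)
    (hpoor : #(poorSensors R) < ε / 2 * n) :
    ∃ A B : Finset (Fin n), Disjoint A B ∧ ε / 2 * n ≤ #A ∧ ε * n ≤ #B ∧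
      NoPrivateLink q R A B := by
  simp only [LargeChunksLinked] at h
  push Not at h
  obtain ⟨A, B, hAB, hA, hB, hfew⟩ := h
  refine ⟨A \ poorSensors R, B, hAB.mono_left Finset.sdiff_subset, ?_, hB, fun a ha => ?_,
    fun b hb a ha => ?_⟩
  · have hcard : (#A : ℝ) ≤ #(A \ poorSensors R) + #(poorSensors R) := by
      exact_mod_cast Finset.card_le_card_sdiff_add_card
    linarith
  · have hrich := mt mem_poorSensors.2 (Finset.mem_sdiff.1 ha).2
    exact (not_lt.1 hrich).trans (Nat.mul_le_mul_left 2
      (Finset.card_le_card (privateKeys_anti R (Finset.subset_univ _) a)))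
  · have haA := (Finset.mem_sdiff.1 ha).1
    exact (Finset.card_le_card (inter_privateKeys_compl_subset haA b)).trans_lt (hfew a haA b hb)

-- The failure bound `exp (-2 / ε)` per sensor of `B` is chosen to leave `exp (-2 n)` for a pair
-- `(A, B)`, which beats the number `4 ^ n` of pairs.
lemma keyLaw_real_exists_noPrivateLink_le (hqK : 4 * q ≤ K) (hK : K ^ 2 ≤ P) {α : ℝ} (hε : 0 < ε)
    (hdeg : 2 ^ q * Real.exp 1 ≤ Real.exp (-(2 / ε)) *
      (α * n * (8⁻¹ ^ q * (1 / (q.factorial : ℝ) * ((K : ℝ) ^ (2 * q) / (P : ℝ) ^ q))))) :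
    (keyLaw n P K).real {R | ∃ A B : Finset (Fin n), Disjoint A B ∧ α * n ≤ #A ∧ ε * n ≤ #B ∧
      NoPrivateLink q R A B} ≤ (4 * Real.exp (-2)) ^ n := by
  classical
  let I : Finset (Finset (Fin n) × Finset (Fin n)) :=
    {p | Disjoint p.1 p.2 ∧ α * n ≤ #p.1 ∧ ε * n ≤ #p.2}
  have hsub : {R : KeyAssignment n P K | ∃ A B : Finset (Fin n), Disjoint A B ∧ α * n ≤ #A ∧
      ε * n ≤ #B ∧ NoPrivateLink q R A B} ⊆ ⋃ p ∈ I, {R | NoPrivateLink q R p.1 p.2} := by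
    rintro R ⟨A, B, hAB, hA, hB, h⟩
    exact Set.mem_biUnion (x := (A, B)) (Finset.mem_filter_univ _ |>.2 ⟨hAB, hA, hB⟩) h
  have hpair : ∀ p ∈ I, (keyLaw n P K).real {R | NoPrivateLink q R p.1 p.2} ≤
      Real.exp (-2) ^ n := by
    intro p hp
    obtain ⟨hAB, hA, hB⟩ := (Finset.mem_filter_univ _).1 hp
    refine (keyLaw_real_noPrivateLink_le hqK hK hAB (Real.exp_pos (-(2 / ε))).le
      (hdeg.trans (by gcongr))).trans ?_
    rw [← Real.exp_nat_mul, ← Real.exp_nat_mul, Real.exp_le_exp]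
    have hscale : n * 2 ≤ #p.2 * (2 / ε) := by
      rw [← mul_div_assoc, le_div_iff₀ hε]
      linarith
    linarith
  have hI : (#I : ℝ) ≤ 4 ^ n := by
    have hcard : Fintype.card (Finset (Fin n) × Finset (Fin n)) = 4 ^ n := by
      simp [← mul_pow]
    exact_mod_cast (Finset.card_le_univ I).trans_eq hcard
  calc (keyLaw n P K).real _
      ≤ ∑ p ∈ I, (keyLaw n P K).real {R | NoPrivateLink q R p.1 p.2} :=
        (measureReal_mono hsub (measure_ne_top _ _)).trans (measureReal_biUnion_finset_le _ _)
    _ ≤ #I * Real.exp (-2) ^ n := by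
        simpa only [nsmul_eq_mul] using Finset.sum_le_card_nsmul I _ _ hpair
    _ ≤ (4 * Real.exp (-2)) ^ n := by
        rw [mul_pow]
        gcongr

lemma keyLaw_real_not_largeChunksLinked_le (hqK : 4 * q ≤ K) (hK : K ^ 2 ≤ P) (hn : 0 < n)
    (hε : 0 < ε)
    (hdeg : 2 ^ q * Real.exp 1 ≤ Real.exp (-(2 / ε)) *
      (ε / 2 * n * (8⁻¹ ^ q * (1 / (q.factorial : ℝ) * ((K : ℝ) ^ (2 * q) / (P : ℝ) ^ q))))) :
    (keyLaw n P K).real {R | ¬ LargeChunksLinked q ε R} ≤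
      4 / ε * (n * ((K : ℝ) / P)) + (4 * Real.exp (-2)) ^ n := by
  have hKP : K ≤ P := (Nat.le_self_pow two_ne_zero K).trans hK
  have hpoor : (keyLaw n P K).real {R | ε / 2 * n ≤ #(poorSensors R)} ≤
      4 / ε * (n * ((K : ℝ) / P)) := by
    have hpos : 0 < ε / 2 * n := by positivity
    refine le_of_mul_le_mul_left ((mul_keyLaw_real_le_card_poorSensors_le hKP _).trans_eq ?_) hpos
    field_simp
    ring
  have hsub : {R : KeyAssignment n P K | ¬ LargeChunksLinked q ε R} ⊆
      {R | ε / 2 * n ≤ #(poorSensors R)} ∪ {R | ∃ A B : Finset (Fin n), Disjoint A B ∧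
        ε / 2 * n ≤ #A ∧ ε * n ≤ #B ∧ NoPrivateLink q R A B} := fun R hR =>
    (le_or_gt (ε / 2 * n) #(poorSensors R)).imp_right
      (exists_noPrivateLink_of_not_largeChunksLinked hR)
  exact (measureReal_mono hsub).trans ((measureReal_union_le _ _).trans
    (add_le_add hpoor (keyLaw_real_exists_noPrivateLink_le hqK hK hε hdeg)))

lemma LargeChunksLinked.not_splitsInto (h : LargeChunksLinked q ε R) (hq : 1 ≤ q)
    {S A B : Finset (Fin n)} (hA : ε * n ≤ #A) (hB : ε * n ≤ #B) : ¬ SplitsInto q R S A B := by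
  rintro ⟨hAB, hS, hsplit⟩
  obtain ⟨a, ha, b, hb, hab⟩ := h A B hAB hA hB
  rw [hS, compl_compl] at hab
  have hsub := hsplit a ha b hb ⟨fun hne => Finset.disjoint_left.1 hAB ha (hne ▸ hb),
    hab.trans (Finset.card_le_card Finset.sdiff_subset)⟩
  rw [Finset.sdiff_eq_empty_iff_subset.2 hsub, Finset.card_empty] at hab
  omega

lemma LargeChunksLinked.exists_connected (h : LargeChunksLinked q ε R) (hε : 0 < ε * n)
    {S : Finset (Fin n)} (hS : 3 * (ε * n) ≤ n - #S) :
    ∃ T : Finset (Fin n), Disjoint T S ∧ (n : ℝ) - (#S + ε * n) ≤ #T ∧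
      ((uncompromisedNetwork q R S).induce (T : Set (Fin n))).Connected := by
  have hcard : (#Sᶜ : ℝ) = n - #S := by
    rw [Finset.card_compl, Nat.cast_sub (Finset.card_le_univ S), Fintype.card_fin]
  have hlinked : ∀ A ⊆ Sᶜ, ∀ B ⊆ Sᶜ, Disjoint A B → ε * n ≤ #A → ε * n ≤ #B →
      ∃ a ∈ A, ∃ b ∈ B, (uncompromisedNetwork q R S).Adj a b := by
    intro A hAS B hBS hAB hA hB
    obtain ⟨a, ha, b, hb, hab⟩ := h A B hAB hA hB
    have hSAB : S ⊆ (A ∪ B)ᶜ := Finset.subset_compl_comm.1 (Finset.union_subset hAS hBS)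
    exact ⟨a, ha, b, hb, fun hne => Finset.disjoint_left.1 hAB ha (hne ▸ hb),
      hab.trans (Finset.card_le_card
        (Finset.sdiff_subset_sdiff subset_rfl (compromisedKeys_mono R hSAB)))⟩
  obtain ⟨T, hTS, hT, hconn⟩ := exists_induce_connected_of_large_linked
    (uncompromisedNetwork q R S) hε (hS.trans_eq hcard.symm) hlinked
  exact ⟨T, Finset.subset_compl_iff_disjoint_right.1 hTS, by linarith, hconn⟩

end Chunks

section WithHighProbability

variable {K P : ℕ → ℕ} {E F : ∀ n, KeyAssignment n (P n) (K n) → Prop}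

lemma withHighProbability_iff (hKP : ∀ᶠ n in atTop, K n ≤ P n) :
    WithHighProbability K P E ↔
      Tendsto (fun n => (keyLaw n (P n) (K n)).real {R | ¬ E n R}) atTop (𝓝 0) := by
  have hcompl : ∀ᶠ n in atTop, (keyLaw n (P n) (K n)).real {R | ¬ E n R} =
      1 - (keyLaw n (P n) (K n)).real {R | E n R} := by
    filter_upwards [hKP] with n hn
    have := isProbabilityMeasure_keyLaw (n := n) hn
    exact probReal_compl_eq_one_sub (measurableSet_keyAssignment {R | E n R})
  rw [WithHighProbability, tendsto_congr' hcompl,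
    ← ENNReal.tendsto_toReal_iff (fun _ => measure_ne_top _ _) ENNReal.one_ne_top,
    ENNReal.toReal_one]
  simp only [← measureReal_def]
  exact ⟨fun h => by simpa using h.const_sub 1, fun h => by simpa using h.const_sub 1⟩

lemma WithHighProbability.mono (hKP : ∀ᶠ n in atTop, K n ≤ P n) (hE : WithHighProbability K P E)
    (h : ∀ᶠ n in atTop, ∀ R, E n R → F n R) : WithHighProbability K P F := by
  refine tendsto_of_tendsto_of_tendsto_of_le_of_le' hE tendsto_const_nhds ?_ ?_
  · filter_upwards [h] with n hn using measure_mono fun R hR => hn R hR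
  · filter_upwards [hKP] with n hn
    have := isProbabilityMeasure_keyLaw (n := n) hn
    exact prob_le_one

lemma exists_tendsto_withHighProbability (hKP : ∀ᶠ n in atTop, K n ≤ P n)
    {E : ℕ → ∀ n, KeyAssignment n (P n) (K n) → Prop} (hE : ∀ k, WithHighProbability K P (E k)) :
    ∃ φ : ℕ → ℕ, Tendsto φ atTop atTop ∧ WithHighProbability K P fun n => E (φ n) n := by
  have hsmall (k : ℕ) : ∀ᶠ n in atTop,
      (keyLaw n (P n) (K n)).real {R | ¬ E k n R} ≤ 1 / ((k : ℝ) + 1) :=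
    ((withHighProbability_iff hKP).1 (hE k)).eventually_le_const (by positivity)
  obtain ⟨φ, hφ, hle⟩ := exists_tendsto_atTop_eventually hsmall
  refine ⟨φ, hφ, (withHighProbability_iff hKP).2 ?_⟩
  exact squeeze_zero' (Eventually.of_forall fun _ => measureReal_nonneg) hle
    (tendsto_one_div_add_atTop_nhds_zero_nat.comp hφ)

end WithHighProbability

section Asymptotics

variable {q : ℕ} {K P : ℕ → ℕ}

lemma eventually_sq_le_of_isLittleO_sqrt
    (h : (fun n => (K n : ℝ)) =o[atTop] fun n => Real.sqrt (P n)) :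
    ∀ᶠ n in atTop, K n ^ 2 ≤ P n := by
  filter_upwards [h.bound one_pos] with n hn
  rw [one_mul, Real.norm_of_nonneg (by positivity), Real.norm_of_nonneg (by positivity),
    Real.le_sqrt (by positivity) (by positivity)] at hn
  exact_mod_cast hn

lemma tendsto_mul_div_of_isLittleO_div
    (h : (fun n => (K n : ℝ)) =o[atTop] fun n : ℕ => (P n : ℝ) / n) :
    Tendsto (fun n : ℕ => n * ((K n : ℝ) / P n)) atTop (𝓝 0) := by
  refine h.tendsto_div_nhds_zero.congr fun n => ?_
  rw [div_div_eq_mul_div]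
  ring

lemma one_div_factorial_mul_pow_div_le_of_sq_le {k p : ℕ} (hq : 1 ≤ q) (hk : k ^ 2 ≤ p) :
    1 / (q.factorial : ℝ) * ((k : ℝ) ^ (2 * q) / (p : ℝ) ^ q) ≤ k * ((k : ℝ) / p) := by
  have hratio : (k : ℝ) ^ 2 / p ≤ 1 := div_le_one_of_le₀ (by exact_mod_cast hk) (by positivity)
  have hfac : 1 / (q.factorial : ℝ) ≤ 1 :=
    div_le_one_of_le₀ (by exact_mod_cast q.factorial_pos) (by positivity)
  calc 1 / (q.factorial : ℝ) * ((k : ℝ) ^ (2 * q) / (p : ℝ) ^ q)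
      ≤ (k : ℝ) ^ (2 * q) / (p : ℝ) ^ q := mul_le_of_le_one_left (by positivity) hfac
    _ = ((k : ℝ) ^ 2 / p) ^ q := by rw [pow_mul, div_pow]
    _ ≤ (k : ℝ) ^ 2 / p := pow_le_of_le_one (by positivity) hratio (by omega)
    _ = k * ((k : ℝ) / p) := by ring

lemma tendsto_ringSize_atTop (hq : 1 ≤ q)
    (hdeg : Tendsto (fun n : ℕ => n * (1 / (q.factorial : ℝ) *
      ((K n : ℝ) ^ (2 * q) / (P n : ℝ) ^ q))) atTop atTop)
    (hsq : ∀ᶠ n in atTop, K n ^ 2 ≤ P n)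
    (hnKP : Tendsto (fun n : ℕ => n * ((K n : ℝ) / P n)) atTop (𝓝 0)) :
    Tendsto K atTop atTop := by
  rw [← tendsto_natCast_atTop_iff (R := ℝ)]
  refine tendsto_atTop_mono' atTop ?_ hdeg
  filter_upwards [hsq, hnKP.eventually_le_const one_pos] with n hn hn1
  calc n * (1 / (q.factorial : ℝ) * ((K n : ℝ) ^ (2 * q) / (P n : ℝ) ^ q))
      ≤ n * (K n * ((K n : ℝ) / P n)) :=
        mul_le_mul_of_nonneg_left (one_div_factorial_mul_pow_div_le_of_sq_le hq hn)
          (Nat.cast_nonneg n)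
    _ = K n * (n * ((K n : ℝ) / P n)) := by ring
    _ ≤ K n := mul_le_of_le_one_right (by positivity) hn1

lemma four_mul_exp_neg_two_lt_one : 4 * Real.exp (-2) < 1 := by
  have hexp : (4 : ℝ) < Real.exp 2 := by
    linarith [Real.quadratic_le_exp_of_nonneg (zero_le_two (α := ℝ))]
  rwa [Real.exp_neg, ← div_eq_mul_inv, div_lt_one (Real.exp_pos 2)]

lemma withHighProbability_largeChunksLinked (hq : 1 ≤ q)
    (hdeg : Tendsto (fun n : ℕ => n * (1 / (q.factorial : ℝ) *
      ((K n : ℝ) ^ (2 * q) / (P n : ℝ) ^ q))) atTop atTop)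
    (hsq : ∀ᶠ n in atTop, K n ^ 2 ≤ P n)
    (hnKP : Tendsto (fun n : ℕ => n * ((K n : ℝ) / P n)) atTop (𝓝 0)) {ε : ℝ} (hε : 0 < ε) :
    WithHighProbability K P fun _ R => LargeChunksLinked q ε R := by
  have hKP : ∀ᶠ n in atTop, K n ≤ P n :=
    hsq.mono fun n hn => (Nat.le_self_pow two_ne_zero (K n)).trans hn
  have hbound : Tendsto
      (fun n : ℕ => 4 / ε * (n * ((K n : ℝ) / P n)) + (4 * Real.exp (-2)) ^ n) atTop (𝓝 0) := by
    simpa using (hnKP.const_mul (4 / ε)).add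
      (tendsto_pow_atTop_nhds_zero_of_lt_one (by positivity) four_mul_exp_neg_two_lt_one)
  have hdeg' := hdeg.const_mul_atTop (r := Real.exp (-(2 / ε)) * (ε / 2 * 8⁻¹ ^ q)) (by positivity)
  refine (withHighProbability_iff hKP).2
    (squeeze_zero' (Eventually.of_forall fun _ => measureReal_nonneg) ?_ hbound)
  filter_upwards [hsq, eventually_gt_atTop 0,
    (tendsto_ringSize_atTop hq hdeg hsq hnKP).eventually_ge_atTop (4 * q),
    hdeg'.eventually_ge_atTop (2 ^ q * Real.exp 1)] with n hKn hn hqK hdegn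
  exact keyLaw_real_not_largeChunksLinked_le hqK hKn hn hε (hdegn.trans_eq (by ring))

lemma unsplittable_of_withHighProbability_largeChunksLinked (hq : 1 ≤ q)
    (hKP : ∀ᶠ n in atTop, K n ≤ P n)
    (h : ∀ ε : ℝ, 0 < ε → WithHighProbability K P fun _ R => LargeChunksLinked q ε R) :
    Unsplittable q K P := by
  refine fun m _ ε hε => (h ε hε).mono hKP (Eventually.of_forall fun n R hR => ?_)
  rintro ⟨S, A, B, -, hsplit, hA, hB⟩
  exact hR.not_splitsInto hq hA hB hsplit

lemma remainsSecurelyConnected_of_withHighProbability_largeChunksLinked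
    (hKP : ∀ᶠ n in atTop, K n ≤ P n)
    (h : ∀ ε : ℝ, 0 < ε → WithHighProbability K P fun _ R => LargeChunksLinked q ε R) :
    RemainsSecurelyConnected q K P := by
  intro m hm
  obtain ⟨φ, hφ, hwhp⟩ := exists_tendsto_withHighProbability hKP
    fun k : ℕ => h (1 / ((k : ℝ) + 1)) (by positivity)
  -- The chunk fraction `ε n` decreases slowly enough for large chunks of that size to stay linked.
  set ε : ℕ → ℝ := fun n => 1 / ((φ n : ℝ) + 1)
  have hεpos (n : ℕ) : 0 < ε n := by positivity
  have hε : Tendsto ε atTop (𝓝 0) := tendsto_one_div_add_atTop_nhds_zero_nat.comp hφ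
  have hεn : (fun n => ε n * n) =o[atTop] fun n : ℕ => (n : ℝ) := by
    simpa using ((isLittleO_one_iff ℝ).2 hε).mul_isBigO (isBigO_refl (fun n : ℕ => (n : ℝ)) atTop)
  refine ⟨fun n => m n + ε n * n, hm.add hεn, hwhp.mono hKP ?_⟩
  filter_upwards [hm.bound (by norm_num : (0 : ℝ) < 1 / 4), eventually_gt_atTop 0,
    hε.eventually_le_const (by norm_num : (0 : ℝ) < 1 / 4)] with n hmn hn hεle R hR S hS
  rw [Real.norm_of_nonneg (by positivity), Real.norm_of_nonneg (by positivity)] at hmn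
  have hSm : (#S : ℝ) ≤ m n := by exact_mod_cast hS
  have hεn_le : ε n * n ≤ 1 / 4 * n := by gcongr
  have hεn_pos : 0 < ε n * n := mul_pos (hεpos n) (by exact_mod_cast hn)
  obtain ⟨T, hTS, hT, hconn⟩ := hR.exists_connected hεn_pos (S := S) (by linarith)
  exact ⟨T, hTS, by linarith, hconn⟩

lemma tendsto_natCast_mul_of_log_div_le {c : ℝ} (hc : 0 < c) {p : ℕ → ℝ}
    (h : ∀ᶠ n : ℕ in atTop, c * Real.log n / n ≤ p n) :
    Tendsto (fun n : ℕ => n * p n) atTop atTop := by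
  have hlog : Tendsto (fun n : ℕ => c * Real.log n) atTop atTop :=
    (Real.tendsto_log_atTop.comp tendsto_natCast_atTop_atTop).const_mul_atTop hc
  refine tendsto_atTop_mono' atTop ?_ hlog
  filter_upwards [h, eventually_gt_atTop 0] with n hn hn0
  rwa [div_le_iff₀' (by exact_mod_cast hn0)] at hn

end Asymptotics

theorem theorem9_general (q : ℕ) (hq : 1 ≤ q) (K P : ℕ → ℕ)
    (hdeg : Tendsto (fun n : ℕ => n * (1 / (q.factorial : ℝ) *
      ((K n : ℝ) ^ (2 * q) / (P n : ℝ) ^ q))) atTop atTop)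
    (hKo : (fun n => (K n : ℝ)) =o[atTop]
      (fun n : ℕ => min (Real.sqrt (P n)) ((P n : ℝ) / n))) :
    Unsplittable q K P ∧ RemainsSecurelyConnected q K P := by
  have hmin (n : ℕ) : 0 ≤ min (Real.sqrt (P n)) ((P n : ℝ) / n) := by positivity
  have hsq : ∀ᶠ n in atTop, K n ^ 2 ≤ P n :=
    eventually_sq_le_of_isLittleO_sqrt
      (hKo.trans_le fun n => abs_le_abs_of_nonneg (hmin n) (min_le_left _ _))
  have hnKP : Tendsto (fun n : ℕ => n * ((K n : ℝ) / P n)) atTop (𝓝 0) :=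
    tendsto_mul_div_of_isLittleO_div
      (hKo.trans_le fun n => abs_le_abs_of_nonneg (hmin n) (min_le_right _ _))
  have hKP : ∀ᶠ n in atTop, K n ≤ P n :=
    hsq.mono fun n hn => (Nat.le_self_pow two_ne_zero (K n)).trans hn
  have hlinked (ε : ℝ) (hε : 0 < ε) := withHighProbability_largeChunksLinked hq hdeg hsq hnKP hε
  exact ⟨unsplittable_of_withHighProbability_largeChunksLinked hq hKP hlinked,
    remainsSecurelyConnected_of_withHighProbability_largeChunksLinked hKP hlinked⟩

theorem theorem9 (q : ℕ) (hq : 1 ≤ q) (K P : ℕ → ℕ)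
    (hKP : ∀ᶠ n in atTop, q ≤ K n ∧ K n ≤ P n)
    (c : ℝ) (hc : 1 < c)
    (hedge : ∀ᶠ n : ℕ in atTop,
      c * Real.log n / n ≤ 1 / (q.factorial : ℝ) * ((K n : ℝ) ^ (2 * q) / (P n : ℝ) ^ q))
    (hKlog : Tendsto (fun n : ℕ => (K n : ℝ) / Real.log n) atTop atTop)
    (hKo : (fun n => (K n : ℝ)) =o[atTop]
      (fun n : ℕ => min (Real.sqrt (P n)) ((P n : ℝ) / n))) :
    Unsplittable q K P ∧ RemainsSecurelyConnected q K P :=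
  theorem9_general q hq K P (tendsto_natCast_mul_of_log_div_le (zero_lt_one.trans hc) hedge) hKo
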